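/- Let $Z$ be a complex normed space with closed unit ball $Z_1$ and dual $U=Z^*$. Elements $f,g\in Z$ are orthogonal, $f\perp g$, if $\|f+g\|=\|f-g\|=\|f\|+\|g\|$, and $S^\perp$ denotes the set of all elements orthogonal to every element of $S\subset Z$. For $x\in U$ put $F_x=\{f\in Z_1: f(x)=1\}$, where $f(x)$ denotes the value of $x$ at $f$; a norm exposed face is a non-empty set of the form $F_x$ with $\|x\|=1$. A norm exposed face $F$ is symmetric if there is a surjective linear isometry $S_F$ of $Z$ with $S_F^2=I$ whose fixed point set is the topological direct sum $\overline{\mathrm{sp}}\,F\oplus F^\perp$ (such an $S_F$, called the symmetry of $F$, is unique). In that case $P_1(F)=(I-S_F)/2$, and $P_2(F),P_0(F)$ are the projections of $Z$ onto $\overline{\mathrm{sp}}\,F$ and $F^\perp$ with $P_2(F)+P_0(F)=(I+S_F)/2$. The space $Z$ is weakly facially symmetric if every norm exposed face is symmetric, and strongly facially symmetric if in addition $S_F^*y=y$ whenever $F$ is a norm exposed face, $y\in U$, $\|y\|=1$ and $F\subset F_y$. A geometric tripotent is an element $u\in U$ with $\|u\|=1$ that vanishes on $F_u^\perp$, such that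 $F_u$ is a symmetric face and $S_{F_u}^*u=u$. For a geometric tripotent $u$ write $S_u=S_{F_u}$ and $U_k(u)=P_k(F_u)^*(U)$, $k=0,1,2$. For geometric tripotents, $u\le v$ means $F_u\subset F_v$; $u$ and $v$ are orthogonal if $u\in U_0(v)$, and colinear if $u\in U_1(v)$ and $v\in U_1(u)$. A geometric tripotent $v$ is minimal if $U_2(v)$ is one dimensional, and indecomposable if every geometric tripotent $u\le v$ equals $v$. Let $\mathcal M$ and $\mathcal I$ be the sets of minimal and of indecomposable geometric tripotents. The weakly facially symmetric space $Z$ is locally base normed if for every symmetric face $F$ each non-zero $f\in \mathrm{sp}_{\mathbf R}F$ can be written $f=g-h$ with $g,h\in\mathbf R^+F=\{tk: t\ge 0,\ k\in F\}$ and $\|f\|=\|g\|+\|h\|$. It is neutral if for every symmetric face $F$ the projection $Q=P_2(F)$ is neutral, that is, contractive and such that $\|Q\xi\|=\|\xi\|$ implies $Q\xi=\xi$. It satisfies JP if for every pair $u,v$ of orthogonal geometric tripotents $S_uS_v=S_{u+v}$, where $S_{u+v}$ is the symmetry of the face $F_{u+v}$. Proposition. Let $Z$ be a locally base normed strongly facially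 symmetric space. (a) $\mathcal I=\mathcal M$. (b) Suppose furthermore that $Z$ is neutral and satisfies JP. If $v\in\mathcal M$ and $w$ is a geometric tripotent colinear with $v$, then $w\in\mathcal M$. -/

import Mathlib

namespace FacialSymmetry

variable {Z : Type*} [NormedAddCommGroup Z] [NormedSpace ℂ Z]

/-! ### Orthogonality, norm exposed faces, symmetries -/

/-- `f` and `g` are orthogonal: `‖f + g‖ = ‖f - g‖ = ‖f‖ + ‖g‖`. -/
def Orthogonal (f g : Z) : Prop :=
  ‖f + g‖ = ‖f‖ + ‖g‖ ∧ ‖f - g‖ = ‖f‖ + ‖g‖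

/-- The set of all elements orthogonal to each element of `A`. -/
def orthSet (A : Set Z) : Set Z := {g | ∀ f ∈ A, Orthogonal f g}

/-- `F_x = {f ∈ Z₁ : f(x) = 1}`, for a functional `x` in the dual. -/
def normFace (x : StrongDual ℂ Z) : Set Z := {f | ‖f‖ ≤ 1 ∧ x f = 1}

/-- Norm exposed faces of the closed unit ball. -/
def IsNormExposedFace (F : Set Z) : Prop :=
  F.Nonempty ∧ ∃ x : StrongDual ℂ Z, ‖x‖ = 1 ∧ F = normFace x

/-- The norm closure of the complex linear span of `F`. -/
def closedSpan (F : Set Z) : Submodule ℂ Z := (Submodule.span ℂ F).topologicalClosure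

/-- `S` is a symmetry associated with `F`: a surjective linear isometry with `S² = I` whose fixed
point set is the topological direct sum of `closedSpan F` and `orthSet F` (which is in particular
a linear subspace). The bound by `C` says that the sum is direct and that the projection onto the
first summand is continuous. -/
def IsSymmetryOf (F : Set Z) (S : Z ≃ₗᵢ[ℂ] Z) : Prop :=
  (∀ f, S (S f) = f) ∧
  ∃ N : Submodule ℂ Z, (N : Set Z) = orthSet F ∧
    (∀ f, S f = f ↔ f ∈ closedSpan F ⊔ N) ∧
    ∃ C : ℝ, ∀ g ∈ closedSpan F, ∀ h ∈ N, ‖g‖ ≤ C * ‖g + h‖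

/-- Symmetric faces. -/
def IsSymmetricFace (F : Set Z) : Prop :=
  IsNormExposedFace F ∧ ∃ S : Z ≃ₗᵢ[ℂ] Z, IsSymmetryOf F S

/-- A symmetry is determined by its face. -/
theorem IsSymmetryOf.unique {F : Set Z} {S T : Z ≃ₗᵢ[ℂ] Z}
    (hS : IsSymmetryOf F S) (hT : IsSymmetryOf F T) : S = T := by
  obtain ⟨hS2, N, hN, hSfix, -⟩ := hS
  obtain ⟨hT2, N', hN', hTfix, -⟩ := hT
  have hNN : N' = N := SetLike.coe_injective (hN'.trans hN.symm)
  subst hNN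
  have hfix : ∀ f, S f = f ↔ T f = f := fun f => (hSfix f).trans (hTfix f).symm
  have hd : ∀ f, S (T f - S f) = T f - S f := by
    intro f
    have h1 : S (f + S f) = f + S f := by rw [map_add, hS2, add_comm]
    have h2 : S (f + T f) = f + T f := (hfix _).2 (by rw [map_add, hT2, add_comm])
    have h3 : T f - S f = (f + T f) - (f + S f) := by abel
    rw [h3, map_sub, h1, h2]
  have hTd : ∀ f, T (T f - S f) = T f - S f := fun f => (hfix _).1 (hd f)
  have hST : ∀ f, S (T f) = f + (T f - S f) := by
    intro f
    have h := hd f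
    rw [map_sub, hS2] at h
    rw [← h]; abel
  have key : ∀ (n : ℕ) f, ‖f + (n : ℂ) • (T f - S f)‖ = ‖f‖ := by
    intro n
    induction n with
    | zero => intro f; simp
    | succ k ih =>
      intro f
      have h1 : S (T (f + (k : ℂ) • (T f - S f))) = f + ((k + 1 : ℕ) : ℂ) • (T f - S f) := by
        rw [map_add, map_add, hST, map_smul, map_smul, hTd, hd]
        push_cast
        rw [add_smul, one_smul]; abel
      rw [← h1, S.norm_map, T.norm_map, ih]
  ext f
  by_contra hne
  have hpos : 0 < ‖T f - S f‖ := norm_pos_iff.2 (sub_ne_zero.2 (Ne.symm hne))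
  obtain ⟨n, hn⟩ := exists_nat_gt (2 * ‖f‖ / ‖T f - S f‖)
  rw [div_lt_iff₀ hpos] at hn
  have h1 : ‖(n : ℂ) • (T f - S f)‖ = n * ‖T f - S f‖ := by rw [norm_smul]; simp
  have h2 : ‖(n : ℂ) • (T f - S f)‖ ≤ ‖f + (n : ℂ) • (T f - S f)‖ + ‖f‖ := by
    have := norm_sub_le (f + (n : ℂ) • (T f - S f)) f
    simpa using this
  rw [key, h1] at h2
  linarith

open Classical in
/-- The symmetry `S_F` associated with a symmetric face `F` (the identity if `F` has none). -/
noncomputable def faceSymm (F : Set Z) : Z ≃ₗᵢ[ℂ] Z :=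
  if h : ∃ S : Z ≃ₗᵢ[ℂ] Z, IsSymmetryOf F S then h.choose else LinearIsometryEquiv.refl ℂ Z

theorem IsSymmetryOf.faceSymm_eq {F : Set Z} {S : Z ≃ₗᵢ[ℂ] Z} (hS : IsSymmetryOf F S) :
    faceSymm F = S := by
  have h : ∃ S : Z ≃ₗᵢ[ℂ] Z, IsSymmetryOf F S := ⟨S, hS⟩
  rw [faceSymm, dif_pos h]
  exact h.choose_spec.unique hS

theorem IsSymmetricFace.isSymmetryOf_faceSymm {F : Set Z} (hF : IsSymmetricFace F) :
    IsSymmetryOf F (faceSymm F) := by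
  obtain ⟨S, hS⟩ := hF.2
  rwa [hS.faceSymm_eq]

/-! ### Geometric Peirce projections -/

/-- `(I + S_F)/2`, the projection onto the fixed point set of `S_F`. -/
noncomputable def fixProj (F : Set Z) : Z →L[ℂ] Z :=
  (2⁻¹ : ℂ) • (ContinuousLinearMap.id ℂ Z + ((faceSymm F).toContinuousLinearEquiv : Z →L[ℂ] Z))

/-- `P` and `(I + S_F)/2 - P` are the components of `(I + S_F)/2` in the two summands of the fixed
point set of `S_F`. -/
def IsPeirceTwo (F : Set Z) (P : Z →L[ℂ] Z) : Prop :=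
  ∀ f, P f ∈ closedSpan F ∧ fixProj F f - P f ∈ orthSet F

theorem IsSymmetricFace.isPeirceTwo_unique {F : Set Z} (hF : IsSymmetricFace F)
    {P Q : Z →L[ℂ] Z} (hP : IsPeirceTwo F P) (hQ : IsPeirceTwo F Q) : P = Q := by
  obtain ⟨-, N, hN, -, C, hC⟩ := hF.isSymmetryOf_faceSymm
  ext f
  have h1 : P f - Q f ∈ closedSpan F := sub_mem (hP f).1 (hQ f).1
  have hPN : fixProj F f - P f ∈ N := by rw [← SetLike.mem_coe, hN]; exact (hP f).2
  have hQN : fixProj F f - Q f ∈ N := by rw [← SetLike.mem_coe, hN]; exact (hQ f).2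
  have h2 := hC _ h1 _ (sub_mem hPN hQN)
  have h3 : P f - Q f + (fixProj F f - P f - (fixProj F f - Q f)) = 0 := by abel
  rw [h3, norm_zero, mul_zero] at h2
  exact sub_eq_zero.1 (norm_le_zero_iff.1 h2)

theorem IsSymmetricFace.exists_isPeirceTwo {F : Set Z} (hF : IsSymmetricFace F) :
    ∃ P : Z →L[ℂ] Z, IsPeirceTwo F P := by
  obtain ⟨hS, N, hN, hfix, C, hC⟩ := hF.isSymmetryOf_faceSymm
  have hmem : ∀ f, fixProj F f ∈ closedSpan F ⊔ N := by
    intro f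
    rw [← hfix]
    simp [fixProj, hS, add_comm]
  have hex : ∀ f, ∃ g ∈ closedSpan F, fixProj F f - g ∈ N := by
    intro f
    obtain ⟨g, hg, h, hh, hgh⟩ := Submodule.mem_sup.1 (hmem f)
    exact ⟨g, hg, by rw [← hgh]; simpa using hh⟩
  have huniq : ∀ k g g', g ∈ closedSpan F → g' ∈ closedSpan F → k - g ∈ N → k - g' ∈ N →
      g = g' := by
    intro k g g' hg hg' h h'
    have h2 := hC _ (sub_mem hg hg') _ (sub_mem h h')
    have h3 : g - g' + (k - g - (k - g')) = 0 := by abel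
    rw [h3, norm_zero, mul_zero] at h2
    exact sub_eq_zero.1 (norm_le_zero_iff.1 h2)
  choose p hp hpN using hex
  let L : Z →ₗ[ℂ] Z :=
    { toFun := p
      map_add' := fun f g => huniq (fixProj F (f + g)) _ _ (hp _) (add_mem (hp f) (hp g)) (hpN _)
        (by
          have h := add_mem (hpN f) (hpN g)
          rw [map_add]
          convert h using 1
          abel)
      map_smul' := fun c f => huniq (fixProj F (c • f)) _ _ (hp _)
        (Submodule.smul_mem _ c (hp f)) (hpN _)
        (by
          have h := Submodule.smul_mem N c (hpN f)
          rw [map_smul]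
          simpa [smul_sub] using h) }
  have hb : ∀ f, ‖L f‖ ≤ |C| * ‖fixProj F‖ * ‖f‖ := by
    intro f
    have h := hC _ (hp f) _ (hpN f)
    have h3 : p f + (fixProj F f - p f) = fixProj F f := by abel
    rw [h3] at h
    calc ‖p f‖ ≤ C * ‖fixProj F f‖ := h
      _ ≤ |C| * ‖fixProj F f‖ := by gcongr; exact le_abs_self C
      _ ≤ |C| * (‖fixProj F‖ * ‖f‖) := by gcongr; exact (fixProj F).le_opNorm f
      _ = |C| * ‖fixProj F‖ * ‖f‖ := by ring
  refine ⟨L.mkContinuous _ hb, fun f => ⟨hp f, ?_⟩⟩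
  rw [← hN]
  exact hpN f

open Classical in
/-- `P₂(F)`, the projection of `Z` onto `closedSpan F`. -/
noncomputable def peirceTwo (F : Set Z) : Z →L[ℂ] Z :=
  if h : ∃ P : Z →L[ℂ] Z, IsPeirceTwo F P then h.choose else 0

theorem IsSymmetricFace.isPeirceTwo_peirceTwo {F : Set Z} (hF : IsSymmetricFace F) :
    IsPeirceTwo F (peirceTwo F) := by
  have h := hF.exists_isPeirceTwo
  rw [peirceTwo, dif_pos h]
  exact h.choose_spec

/-- `P₁(F) = (I - S_F)/2`, the projection onto the `-1` eigenspace of `S_F`. -/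
noncomputable def peirceOne (F : Set Z) : Z →L[ℂ] Z :=
  (2⁻¹ : ℂ) • (ContinuousLinearMap.id ℂ Z - ((faceSymm F).toContinuousLinearEquiv : Z →L[ℂ] Z))

/-- `P₀(F)`, the projection of `Z` onto `orthSet F`, with `P₂(F) + P₀(F) = (I + S_F)/2`. -/
noncomputable def peirceZero (F : Set Z) : Z →L[ℂ] Z := fixProj F - peirceTwo F

/-- The range in the dual of the adjoint `P*` of `P`. -/
noncomputable def adjointRange (P : Z →L[ℂ] Z) : Submodule ℂ (StrongDual ℂ Z) :=
  LinearMap.range (ContinuousLinearMap.precomp ℂ P).toLinearMap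

/-- `U₂(u) = P₂(F_u)* Z*`. -/
noncomputable def U₂ (u : StrongDual ℂ Z) : Submodule ℂ (StrongDual ℂ Z) :=
  adjointRange (peirceTwo (normFace u))

/-- `U₁(u) = P₁(F_u)* Z*`. -/
noncomputable def U₁ (u : StrongDual ℂ Z) : Submodule ℂ (StrongDual ℂ Z) :=
  adjointRange (peirceOne (normFace u))

/-- `U₀(u) = P₀(F_u)* Z*`. -/
noncomputable def U₀ (u : StrongDual ℂ Z) : Submodule ℂ (StrongDual ℂ Z) :=
  adjointRange (peirceZero (normFace u))

/-! ### Geometric tripotents -/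

/-- Projective units: `‖u‖ = 1` and `u` vanishes on `F_u^⊥`. -/
def IsProjectiveUnit (u : StrongDual ℂ Z) : Prop :=
  ‖u‖ = 1 ∧ ∀ f ∈ orthSet (normFace u), u f = 0

/-- Geometric tripotents: projective units `u` such that `F_u` is a symmetric face and
`S* u = u` for the symmetry `S` of `F_u`. -/
def IsGeometricTripotent (u : StrongDual ℂ Z) : Prop :=
  IsProjectiveUnit u ∧ IsSymmetricFace (normFace u) ∧ ∀ f, u (faceSymm (normFace u) f) = u f

/-- Minimal geometric tripotents: `U₂(v)` is one dimensional. -/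
def IsMinimalTripotent (v : StrongDual ℂ Z) : Prop :=
  IsGeometricTripotent v ∧ Module.finrank ℂ (U₂ v) = 1

/-- Indecomposable geometric tripotents: `u ≤ v` (that is, `F_u ⊆ F_v`) implies `u = v`, for every
geometric tripotent `u`. -/
def IsIndecomposableTripotent (v : StrongDual ℂ Z) : Prop :=
  IsGeometricTripotent v ∧
    ∀ u : StrongDual ℂ Z, IsGeometricTripotent u → normFace u ⊆ normFace v → u = v

/-- Colinearity of geometric tripotents. -/
def Colinear (u v : StrongDual ℂ Z) : Prop := u ∈ U₁ v ∧ v ∈ U₁ u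

/-! ### Axioms on the space -/

variable (Z)

/-- Weakly facially symmetric spaces: every norm exposed face is symmetric. -/
def WeaklyFaciallySymmetric : Prop :=
  ∀ F : Set Z, IsNormExposedFace F → IsSymmetricFace F

/-- Strongly facially symmetric spaces. -/
def StronglyFaciallySymmetric : Prop :=
  WeaklyFaciallySymmetric Z ∧
    ∀ F : Set Z, IsNormExposedFace F → ∀ y : StrongDual ℂ Z, ‖y‖ = 1 → F ⊆ normFace y →
      ∀ f, y (faceSymm F f) = y f

variable {Z}

/-- The Jordan decomposition property of a face: every non-zero `f` in the real span of `F` is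
`s • g - t • h` with `s, t ≥ 0`, `g, h ∈ F` and `‖f‖ = ‖s • g‖ + ‖t • h‖`. -/
def HasJordanDecomposition (F : Set Z) : Prop :=
  ∀ f ∈ Submodule.span ℝ F, f ≠ 0 →
    ∃ g ∈ F, ∃ h ∈ F, ∃ s t : ℝ, 0 ≤ s ∧ 0 ≤ t ∧ f = s • g - t • h ∧ ‖f‖ = ‖s • g‖ + ‖t • h‖

/-- Neutral contractive projections. -/
def IsNeutralProjection (Q : Z →L[ℂ] Z) : Prop :=
  (∀ f, Q (Q f) = Q f) ∧ (∀ f, ‖Q f‖ ≤ ‖f‖) ∧ ∀ f, ‖Q f‖ = ‖f‖ → Q f = f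

variable (Z)

/-- Locally base normed spaces (property JD). -/
def LocallyBaseNormed : Prop :=
  WeaklyFaciallySymmetric Z ∧ ∀ F : Set Z, IsSymmetricFace F → HasJordanDecomposition F

/-- Neutral spaces. -/
def Neutral : Prop := ∀ F : Set Z, IsSymmetricFace F → IsNeutralProjection (peirceTwo F)

/-- Property JP: `S_u S_v = S_{u+v}` for orthogonal geometric tripotents `u`, `v`. -/
def PropertyJP : Prop :=
  ∀ u v : StrongDual ℂ Z, IsGeometricTripotent u → IsGeometricTripotent v → u ∈ U₀ v →
    ∀ f, faceSymm (normFace u) (faceSymm (normFace v) f) = faceSymm (normFace (u + v)) f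

end FacialSymmetry

/-!
The face of a geometric tripotent `v` carries all the information: `v` is determined by it
(`IsGeometricTripotent.eq_of_normFace_eq`), and `v` is minimal if and only if its face is a single
point (`IsGeometricTripotent.isMinimalTripotent_iff`). Two tools give access to faces.

* If `u = 1` on a symmetric face `F`, then `|u(g)| + ‖h‖ ≤ ‖g + h‖` for `g` in the closed span of
  `F` and `h ⊥ F` (`IsSymmetricFace.norm_apply_add_norm_le`). In a strongly facially symmetric space
  it follows that every norm exposed face is the face of a geometric tripotent
  (`StronglyFaciallySymmetric.exists_tripotent`).
* By the Jordan decomposition, a face `F_v` with more than one point contains points `g`, `h` at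
  distance two. A functional which separates them cuts out a proper norm exposed face of `F_v`, that
  is, a geometric tripotent `u ≤ v`, `u ≠ v`. Thus indecomposable tripotents are minimal, and the
  converse is immediate.

Now let `F_v = {f}`, let `w` be colinear with `v`, and suppose that `F_w` has more than one point.
First, `S_v = -1` on `F_w` (`faceSymm_eq_neg_of_colinear`): otherwise the involution `-S_v` of `F_w`
interchanges two of its points `k₁`, `k₂` with `‖k₁ - k₂‖ = 2`; then `k₁ - k₂` is orthogonal to `f`,
which forces `k₁ ⊥ f` and `S_v k₁ = k₁`.
Secondly, `w = u + w'` for orthogonal geometric tripotents `u`, `w'`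
(`StronglyFaciallySymmetric.exists_add_eq`), and `S_u S_{w'} = S_w` by JP. As `S_u` commutes with
`S_v`, the extreme point `S_u f` is `f`, `-f`, or orthogonal to `f`
(`IsMinimalTripotent.map_eq_or_mem_orthSet`). Since `S_w f = -f`, the vector `x = f` in the first
two cases, and `x = (f + S_u f) / 2` in the third, is a unit vector fixed by `S_u` or `S_{w'}` and
hence orthogonal to the face of `u` or of `w'`. So some functional `y` of norm one is `1` both at `x` and
at a point `k` of `F_w`. It is then `1` at `f`, so `S_v* y = y` by strong facial symmetry, and
`y(k) = y(S_v k) = -y(k)`, a contradiction.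
-/

namespace FacialSymmetry

variable {Z : Type*} [NormedAddCommGroup Z]

/-! ### Orthogonality -/

theorem Orthogonal.symm {f g : Z} (h : Orthogonal f g) : Orthogonal g f :=
  ⟨by rw [add_comm, h.1, add_comm], by rw [norm_sub_rev, h.2, add_comm]⟩

theorem Orthogonal.neg_left {f g : Z} (h : Orthogonal f g) : Orthogonal (-f) g := by
  refine ⟨?_, ?_⟩
  · rw [← norm_neg (-f + g), norm_neg f, ← h.2]; congr 1; abel
  · rw [← norm_neg (-f - g), norm_neg f, ← h.1]; congr 1; abel

theorem orthSet_anti {A B : Set Z} (h : A ⊆ B) : orthSet B ⊆ orthSet A :=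
  fun _ hg f hf => hg f (h hf)

variable [NormedSpace ℂ Z]

/-! ### Supporting functionals -/

theorem eq_of_norm_le_of_add_eq {z w : ℂ} {a b : ℝ} (hz : ‖z‖ ≤ a) (hw : ‖w‖ ≤ b)
    (h : z + w = ((a + b : ℝ) : ℂ)) : z = a ∧ w = b := by
  have hre : z.re + w.re = a + b := by simpa using congrArg Complex.re h
  have h1 := Complex.re_le_norm z
  have h2 := Complex.re_le_norm w
  have hz1 : z.re = a := by linarith
  have hw1 : w.re = b := by linarith
  have hzn : z.re = ‖z‖ := by linarith
  have hwn : w.re = ‖w‖ := by linarith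
  have hz2 : z.im = 0 := Complex.abs_re_eq_norm.1 (by rw [hzn, abs_of_nonneg (norm_nonneg z)])
  have hw2 : w.im = 0 := Complex.abs_re_eq_norm.1 (by rw [hwn, abs_of_nonneg (norm_nonneg w)])
  exact ⟨Complex.ext (by simpa using hz1) (by simpa using hz2),
    Complex.ext (by simpa using hw1) (by simpa using hw2)⟩

theorem exists_dual_of_norm_add_eq {a b : Z} (ha : ‖a‖ = 1) (h : ‖a + b‖ = ‖a‖ + ‖b‖) :
    ∃ y : StrongDual ℂ Z, ‖y‖ = 1 ∧ y a = 1 ∧ y b = ‖b‖ := by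
  obtain ⟨y, hy, hyab⟩ := exists_dual_vector'' ℂ (a + b)
  have hle : ∀ c, ‖y c‖ ≤ ‖c‖ := fun c => by simpa using y.le_of_opNorm_le hy c
  obtain ⟨h1, h2⟩ := eq_of_norm_le_of_add_eq (hle a) (hle b) (by
    rw [← map_add, hyab, h]; rfl)
  rw [ha, Complex.ofReal_one] at h1
  refine ⟨y, le_antisymm hy ?_, h1, h2⟩
  have := y.le_opNorm a
  rwa [h1, ha, norm_one, mul_one] at this

/-- A functional of norm at most one which takes the value `1` at the midpoint of two points of the
unit ball takes the value `1` at both. -/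
theorem apply_eq_one_of_apply_add_eq_two {y : StrongDual ℂ Z} (hy : ‖y‖ ≤ 1) {a b : Z}
    (ha : ‖a‖ ≤ 1) (hb : ‖b‖ ≤ 1) (h : y a + y b = 2) : y a = 1 ∧ y b = 1 := by
  have hle : ∀ c, ‖y c‖ ≤ ‖c‖ := fun c => by simpa using y.le_of_opNorm_le hy c
  have := eq_of_norm_le_of_add_eq ((hle a).trans ha) ((hle b).trans hb)
    (by rw [h]; norm_num)
  simpa using this

theorem norm_eq_one_of_mem_normFace {x : StrongDual ℂ Z} (hx : ‖x‖ ≤ 1) {f : Z}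
    (hf : f ∈ normFace x) : ‖f‖ = 1 := by
  refine le_antisymm hf.1 ?_
  have := x.le_of_opNorm_le hx f
  simpa [hf.2] using this

theorem midpoint_mem_normFace {x : StrongDual ℂ Z} {f g : Z} (hf : f ∈ normFace x)
    (hg : g ∈ normFace x) : (2⁻¹ : ℂ) • (f + g) ∈ normFace x := by
  refine ⟨?_, ?_⟩
  · rw [norm_smul]
    have := norm_add_le f g
    have := hf.1
    have := hg.1
    norm_num
    linarith
  · rw [map_smul, map_add, hf.2, hg.2]
    norm_num

theorem Orthogonal.map (T : Z ≃ₗᵢ[ℂ] Z) {f g : Z} (h : Orthogonal f g) :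
    Orthogonal (T f) (T g) := by
  refine ⟨?_, ?_⟩
  · rw [← map_add, T.norm_map, T.norm_map, T.norm_map, h.1]
  · rw [← map_sub, T.norm_map, T.norm_map, T.norm_map, h.2]

/-! ### Symmetric faces and their symmetries -/

theorem subset_closedSpan (F : Set Z) : F ⊆ closedSpan F :=
  Submodule.subset_span.trans (Submodule.le_topologicalClosure _)

theorem closedSpan_singleton (f : Z) : closedSpan {f} = Submodule.span ℂ {f} :=
  (Submodule.closed_of_finiteDimensional _).submodule_topologicalClosure_eq

theorem eqOn_closedSpan {F : Set Z} {y z : StrongDual ℂ Z} (h : ∀ f ∈ F, y f = z f) :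
    ∀ g ∈ closedSpan F, y g = z g := by
  have hle : closedSpan F ≤ LinearMap.ker ((y - z : StrongDual ℂ Z) : Z →ₗ[ℂ] ℂ) := by
    refine Submodule.topologicalClosure_minimal _ (Submodule.span_le.2 fun f hf => ?_)
      (ContinuousLinearMap.isClosed_ker (y - z))
    simp [h f hf]
  intro g hg
  have := hle hg
  simpa [sub_eq_zero] using this

namespace IsSymmetricFace

variable {F : Set Z}

theorem faceSymm_faceSymm (hF : IsSymmetricFace F) (f : Z) : faceSymm F (faceSymm F f) = f :=
  hF.isSymmetryOf_faceSymm.1 f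

theorem faceSymm_of_mem_closedSpan (hF : IsSymmetricFace F) {f : Z} (hf : f ∈ closedSpan F) :
    faceSymm F f = f := by
  obtain ⟨-, N, -, hfix, -⟩ := hF.isSymmetryOf_faceSymm
  exact (hfix f).2 (Submodule.mem_sup_left hf)

theorem faceSymm_of_mem_orthSet (hF : IsSymmetricFace F) {f : Z} (hf : f ∈ orthSet F) :
    faceSymm F f = f := by
  obtain ⟨-, N, hN, hfix, -⟩ := hF.isSymmetryOf_faceSymm
  exact (hfix f).2 (Submodule.mem_sup_right (by rwa [← SetLike.mem_coe, hN]))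

theorem exists_add_of_faceSymm_eq (hF : IsSymmetricFace F) {f : Z} (hf : faceSymm F f = f) :
    ∃ g ∈ closedSpan F, ∃ h ∈ orthSet F, f = g + h := by
  obtain ⟨-, N, hN, hfix, -⟩ := hF.isSymmetryOf_faceSymm
  obtain ⟨g, hg, h, hh, e⟩ := Submodule.mem_sup.1 ((hfix f).1 hf)
  exact ⟨g, hg, h, by rw [← hN]; exact hh, e.symm⟩

theorem smul_mem_orthSet (hF : IsSymmetricFace F) (c : ℂ) {f : Z} (hf : f ∈ orthSet F) :
    c • f ∈ orthSet F := by
  obtain ⟨-, N, hN, -⟩ := hF.isSymmetryOf_faceSymm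
  rw [← hN] at hf ⊢
  exact N.smul_mem c hf

theorem sub_mem_orthSet (hF : IsSymmetricFace F) {f g : Z} (hf : f ∈ orthSet F)
    (hg : g ∈ orthSet F) : f - g ∈ orthSet F := by
  obtain ⟨-, N, hN, -⟩ := hF.isSymmetryOf_faceSymm
  rw [← hN] at hf hg ⊢
  exact N.sub_mem hf hg

theorem eq_zero_of_mem_of_mem (hF : IsSymmetricFace F) {f : Z} (hf : f ∈ closedSpan F)
    (hf' : f ∈ orthSet F) : f = 0 := by
  obtain ⟨-, N, hN, -, C, hC⟩ := hF.isSymmetryOf_faceSymm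
  rw [← hN] at hf'
  have := hC f hf (-f) (N.neg_mem hf')
  rw [add_neg_cancel, norm_zero, mul_zero] at this
  exact norm_le_zero_iff.1 this

theorem faceSymm_average (hF : IsSymmetricFace F) (f : Z) :
    faceSymm F ((2⁻¹ : ℂ) • (f + faceSymm F f)) = (2⁻¹ : ℂ) • (f + faceSymm F f) := by
  rw [map_smul, map_add, hF.faceSymm_faceSymm, add_comm]

theorem norm_average_le (F : Set Z) (f : Z) : ‖(2⁻¹ : ℂ) • (f + faceSymm F f)‖ ≤ ‖f‖ := by
  have := norm_add_le f (faceSymm F f)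
  rw [(faceSymm F).norm_map] at this
  rw [norm_smul]
  norm_num
  linarith

theorem apply_average (F : Set Z) {y : StrongDual ℂ Z} (hy : ∀ f, y (faceSymm F f) = y f) (f : Z) :
    y ((2⁻¹ : ℂ) • (f + faceSymm F f)) = y f := by
  rw [map_smul, map_add, hy, smul_eq_mul]
  ring

/-- The sum `closedSpan F + orthSet F` dominates an `ℓ¹`-sum as far as a functional constantly equal
to one on `F` can see. A vector of the span of `F` is a combination of finitely many points of `F`,
and a functional of norm one which is `1` at their average is `1` at each of them. -/
theorem norm_apply_add_norm_le (hF : IsSymmetricFace F) {u : StrongDual ℂ Z}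
    (hu : ∀ f ∈ F, u f = 1) {g h : Z} (hg : g ∈ closedSpan F) (hh : h ∈ orthSet F) :
    ‖u g‖ + ‖h‖ ≤ ‖g + h‖ := by
  obtain ⟨hne, x, hx, rfl⟩ := hF.1
  have key : ∀ g ∈ Submodule.span ℂ (normFace x), ∃ f ∈ normFace x,
      ∀ y : StrongDual ℂ Z, ‖y‖ = 1 → y f = 1 → y g = u g := by
    intro g hg
    induction hg using Submodule.span_induction with
    | mem f hf => exact ⟨f, hf, fun y _ hyf => by rw [hyf, hu f hf]⟩
    | zero => exact ⟨hne.some, hne.some_mem, fun y _ _ => by simp⟩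
    | add a b _ _ iha ihb =>
      obtain ⟨p, hp, hpy⟩ := iha
      obtain ⟨q, hq, hqy⟩ := ihb
      refine ⟨_, midpoint_mem_normFace hp hq, fun y hy1 hy => ?_⟩
      rw [map_smul, map_add, smul_eq_mul] at hy
      obtain ⟨h1, h2⟩ := apply_eq_one_of_apply_add_eq_two hy1.le hp.1 hq.1
        (by linear_combination 2 * hy)
      rw [map_add, map_add, hpy y hy1 h1, hqy y hy1 h2]
    | smul c a _ iha =>
      obtain ⟨p, hp, hpy⟩ := iha
      exact ⟨p, hp, fun y hy1 hy => by rw [map_smul, map_smul, hpy y hy1 hy]⟩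
  have hspan : ∀ g ∈ Submodule.span ℂ (normFace x), ‖u g‖ + ‖h‖ ≤ ‖g + h‖ := by
    intro g hg
    obtain ⟨f, hf, hfy⟩ := key g hg
    -- a unimodular factor which aligns the phases of `u g` and of the contribution of `h`
    obtain ⟨c, hc, hcu⟩ : ∃ c : ℂ, ‖c‖ = 1 ∧ c * u g = ‖u g‖ := by
      by_cases h0 : u g = 0
      · exact ⟨1, by simp, by simp [h0]⟩
      · have h0' : (‖u g‖ : ℂ) ≠ 0 := by simpa using h0
        refine ⟨‖u g‖ / u g, by simp [h0], by field_simp⟩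
    have hf1 := norm_eq_one_of_mem_normFace hx.le hf
    obtain ⟨y, hy1, hyf, hyh⟩ := exists_dual_of_norm_add_eq hf1
      (hF.smul_mem_orthSet c hh f hf).1
    have e : y (c • (g + h)) = ((‖u g‖ + ‖h‖ : ℝ) : ℂ) := by
      rw [smul_add, map_add, hyh, map_smul, hfy y hy1 hyf, smul_eq_mul, hcu, norm_smul, hc]
      simp
    have h2 := y.le_opNorm (c • (g + h))
    rw [e, hy1, norm_smul, hc, Complex.norm_real, one_mul, one_mul, Real.norm_eq_abs] at h2
    exact (le_abs_self _).trans h2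
  have hcl : IsClosed {g : Z | ‖u g‖ + ‖h‖ ≤ ‖g + h‖} :=
    isClosed_le (by fun_prop) (by fun_prop)
  exact closure_minimal (s := (Submodule.span ℂ (normFace x) : Set Z)) hspan hcl hg

theorem ext_dual (hF : IsSymmetricFace F) {y z : StrongDual ℂ Z}
    (hy : ∀ f, y (faceSymm F f) = y f) (hz : ∀ f, z (faceSymm F f) = z f)
    (hy0 : ∀ f ∈ orthSet F, y f = 0) (hz0 : ∀ f ∈ orthSet F, z f = 0)
    (hyz : ∀ f ∈ F, y f = z f) : y = z := by
  ext f
  rw [← apply_average F hy f, ← apply_average F hz f]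
  obtain ⟨g, hg, h, hh, e⟩ := hF.exists_add_of_faceSymm_eq (hF.faceSymm_average f)
  rw [e, map_add, map_add, eqOn_closedSpan hyz g hg, hy0 h hh, hz0 h hh]

/-- An involutive isometry which preserves the two summands belonging to `F` commutes with the
symmetry of `F`, by uniqueness of the symmetry. -/
theorem commute_faceSymm (hF : IsSymmetricFace F) (T : Z ≃ₗᵢ[ℂ] Z) (hT : ∀ f, T (T f) = f)
    (hT2 : ∀ f ∈ closedSpan F, T f ∈ closedSpan F) (hT0 : ∀ f ∈ orthSet F, T f ∈ orthSet F)
    (f : Z) : faceSymm F (T f) = T (faceSymm F f) := by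
  have hS := hF.isSymmetryOf_faceSymm
  obtain ⟨hS2, N, hN, hfix, hC⟩ := hS
  have hTfix : ∀ f, f ∈ closedSpan F ⊔ N → T f ∈ closedSpan F ⊔ N := by
    intro f hf
    obtain ⟨g, hg, h, hh, rfl⟩ := Submodule.mem_sup.1 hf
    rw [map_add]
    refine Submodule.add_mem_sup (hT2 g hg) ?_
    rw [← SetLike.mem_coe, hN] at hh ⊢
    exact hT0 h hh
  have hS' : IsSymmetryOf F ((T.trans (faceSymm F)).trans T) := by
    refine ⟨fun f => ?_, N, hN, fun f => ?_, hC⟩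
    · simp [hT, hS2]
    · have e : ((T.trans (faceSymm F)).trans T) f = f ↔ faceSymm F (T f) = T f := by
        simp only [LinearIsometryEquiv.trans_apply]
        exact ⟨fun h => by rw [← hT (faceSymm F (T f)), h], fun h => by rw [h, hT]⟩
      rw [e, hfix]
      exact ⟨fun h => by simpa [hT] using hTfix _ h, hTfix f⟩
  have := congrArg (fun R : Z ≃ₗᵢ[ℂ] Z => R f) hS'.faceSymm_eq
  simp only [LinearIsometryEquiv.trans_apply] at this
  rw [this, hT]

theorem map_mem_orthSet (T : Z ≃ₗᵢ[ℂ] Z)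
    (hT2 : (∀ f ∈ F, T f = f) ∨ ∀ f ∈ F, T f = -f) {h : Z} (hh : h ∈ orthSet F) :
    T h ∈ orthSet F := by
  intro f hf
  have := (hh f hf).map T
  rcases hT2 with hT2 | hT2
  · rwa [hT2 f hf] at this
  · rw [hT2 f hf] at this
    simpa using this.neg_left

theorem commute_faceSymm_of_eq (hF : IsSymmetricFace F) (T : Z ≃ₗᵢ[ℂ] Z) (hT : ∀ f, T (T f) = f)
    (hT2 : (∀ f ∈ F, T f = f) ∨ ∀ f ∈ F, T f = -f)
    (f : Z) : faceSymm F (T f) = T (faceSymm F f) := by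
  refine hF.commute_faceSymm T hT ?_ (fun h hh => map_mem_orthSet T hT2 hh) f
  have hle : closedSpan F ≤ (closedSpan F).comap (T.toLinearEquiv : Z →ₗ[ℂ] Z) := by
    refine Submodule.topologicalClosure_minimal _ (Submodule.span_le.2 fun f hf => ?_) ?_
    · have hf' := subset_closedSpan F hf
      rcases hT2 with hT2 | hT2
      · simpa [hT2 f hf] using hf'
      · simpa [hT2 f hf] using hf'
    · exact (Submodule.isClosed_topologicalClosure _).preimage T.continuous
  exact fun f hf => hle hf

theorem peirceTwo_eq (hF : IsSymmetricFace F) {f g : Z} (hg : g ∈ closedSpan F)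
    (h : (2⁻¹ : ℂ) • (f + faceSymm F f) - g ∈ orthSet F) : peirceTwo F f = g := by
  have h1 := hF.isPeirceTwo_peirceTwo f
  have h2 : peirceTwo F f - g ∈ orthSet F := by
    have := hF.sub_mem_orthSet h h1.2
    simpa [fixProj] using this
  exact sub_eq_zero.1 (hF.eq_zero_of_mem_of_mem (sub_mem h1.1 hg) h2)

theorem average_eq (hF : IsSymmetricFace F) (f : Z) :
    ∃ h ∈ orthSet F, (2⁻¹ : ℂ) • (f + faceSymm F f) = peirceTwo F f + h :=
  ⟨_, (hF.isPeirceTwo_peirceTwo f).2, by simp [fixProj]⟩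

theorem peirceTwo_faceSymm (hF : IsSymmetricFace F) (f : Z) :
    peirceTwo F (faceSymm F f) = peirceTwo F f := by
  refine hF.peirceTwo_eq (hF.isPeirceTwo_peirceTwo f).1 ?_
  rw [hF.faceSymm_faceSymm, add_comm]
  simpa [fixProj] using (hF.isPeirceTwo_peirceTwo f).2

theorem peirceTwo_of_mem_closedSpan (hF : IsSymmetricFace F) {f : Z} (hf : f ∈ closedSpan F) :
    peirceTwo F f = f := by
  refine hF.peirceTwo_eq hf ?_
  rw [hF.faceSymm_of_mem_closedSpan hf, ← two_smul ℂ f, smul_smul]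
  norm_num
  obtain ⟨-, N, hN, -⟩ := hF.isSymmetryOf_faceSymm
  rw [← hN]
  exact N.zero_mem

theorem peirceTwo_of_mem_orthSet (hF : IsSymmetricFace F) {f : Z} (hf : f ∈ orthSet F) :
    peirceTwo F f = 0 := by
  refine hF.peirceTwo_eq (zero_mem _) ?_
  rw [hF.faceSymm_of_mem_orthSet hf, ← two_smul ℂ f, smul_smul]
  simpa using hf

end IsSymmetricFace

/-! ### Geometric tripotents and their faces -/

namespace IsGeometricTripotent

variable {u v w : StrongDual ℂ Z}

theorem norm_eq (hu : IsGeometricTripotent u) : ‖u‖ = 1 := hu.1.1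

theorem symmetric (hu : IsGeometricTripotent u) : IsSymmetricFace (normFace u) := hu.2.1

theorem apply_peirceTwo (hu : IsGeometricTripotent u) (f : Z) :
    u (peirceTwo (normFace u) f) = u f := by
  obtain ⟨h, hh, e⟩ := hu.symmetric.average_eq f
  rw [← IsSymmetricFace.apply_average (normFace u) hu.2.2 f, e, map_add, hu.1.2 h hh, add_zero]

/-- An involutive isometry which fixes the face of `u` pointwise also fixes `u`. -/
theorem apply_isometry_eq (hu : IsGeometricTripotent u) (T : Z ≃ₗᵢ[ℂ] Z)
    (hT2 : ∀ f, T (T f) = f) (hT : ∀ f ∈ normFace u, T f = f) (f : Z) : u (T f) = u f := by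
  have hcomm := hu.symmetric.commute_faceSymm_of_eq T hT2 (Or.inl hT)
  have e : u.comp ((T.toContinuousLinearEquiv : Z →L[ℂ] Z)) = u := by
    refine hu.symmetric.ext_dual (fun f => ?_) hu.2.2 (fun f hf => ?_) hu.1.2 (fun f hf => ?_)
    · simp only [ContinuousLinearMap.comp_apply, ContinuousLinearEquiv.coe_coe,
        LinearIsometryEquiv.coe_toContinuousLinearEquiv]
      rw [← hcomm, hu.2.2]
    · exact hu.1.2 _ (IsSymmetricFace.map_mem_orthSet T (Or.inl hT) hf)
    · exact congrArg u (hT f hf)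
  exact congrArg (fun y : StrongDual ℂ Z => y f) e

theorem apply_faceSymm_of_orthogonal (hu : IsGeometricTripotent u) (hv : IsGeometricTripotent v)
    (h : normFace u ⊆ orthSet (normFace v)) (f : Z) : u (faceSymm (normFace v) f) = u f :=
  hu.apply_isometry_eq _ hv.symmetric.faceSymm_faceSymm
    (fun _ hk => hv.symmetric.faceSymm_of_mem_orthSet (h hk)) f

theorem apply_eq_zero_of_orthogonal (hu : IsGeometricTripotent u)
    (h : normFace u ⊆ orthSet (normFace v)) {f : Z} (hf : f ∈ closedSpan (normFace v)) :
    u f = 0 := by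
  have := eqOn_closedSpan (y := u) (z := 0) (F := normFace v)
    (fun g hg => hu.1.2 g fun k hk => (h hk g hg).symm) f hf
  simpa using this

theorem mem_U₀_of_orthogonal (hu : IsGeometricTripotent u) (hv : IsGeometricTripotent v)
    (h : normFace u ⊆ orthSet (normFace v)) : u ∈ U₀ v := by
  refine ⟨u, ?_⟩
  ext f
  change u (peirceZero (normFace v) f) = u f
  have h1 : fixProj (normFace v) f = (2⁻¹ : ℂ) • (f + faceSymm (normFace v) f) := by
    simp [fixProj]
  rw [peirceZero, sub_apply, map_sub,
    hu.apply_eq_zero_of_orthogonal h (hv.symmetric.isPeirceTwo_peirceTwo f).1, sub_zero, h1]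
  exact IsSymmetricFace.apply_average _ (hu.apply_faceSymm_of_orthogonal hv h) f

theorem apply_faceSymm_of_subset (hu : IsGeometricTripotent u) (hv : IsGeometricTripotent v)
    (h : normFace u ⊆ normFace v) (f : Z) : u (faceSymm (normFace v) f) = u f :=
  hu.apply_isometry_eq _ hv.symmetric.faceSymm_faceSymm
    (fun _ hk => hv.symmetric.faceSymm_of_mem_closedSpan (subset_closedSpan _ (h hk))) f

theorem eq_of_normFace_eq (hu : IsGeometricTripotent u) (hv : IsGeometricTripotent v)
    (h : normFace u = normFace v) : u = v := by
  refine hv.symmetric.ext_dual ?_ hv.2.2 ?_ hv.1.2 ?_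
  · rw [← h]; exact hu.2.2
  · rw [← h]; exact hu.1.2
  · intro f hf
    rw [hf.2, (h.symm ▸ hf : f ∈ normFace u).2]

theorem apply_faceSymm_of_mem_U₁ (hv : IsGeometricTripotent v) (hw : w ∈ U₁ v) (f : Z) :
    w (faceSymm (normFace v) f) = -w f := by
  obtain ⟨z, rfl⟩ := hw
  change z (peirceOne (normFace v) (faceSymm (normFace v) f)) = -z (peirceOne (normFace v) f)
  rw [← map_neg]
  congr 1
  simp only [peirceOne, smul_apply, sub_apply,
    ContinuousLinearMap.id_apply, ContinuousLinearEquiv.coe_coe,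
    LinearIsometryEquiv.coe_toContinuousLinearEquiv, hv.symmetric.faceSymm_faceSymm]
  rw [← smul_neg, neg_sub]

end IsGeometricTripotent

/-! ### The tripotent of a norm exposed face -/

theorem StronglyFaciallySymmetric.apply_faceSymm (hSFS : StronglyFaciallySymmetric Z)
    {x y : StrongDual ℂ Z} (hne : (normFace x).Nonempty) (hx : ‖x‖ = 1) (hy : ‖y‖ = 1)
    (h : normFace x ⊆ normFace y) (f : Z) : y (faceSymm (normFace x) f) = y f :=
  hSFS.2 _ ⟨hne, x, hx, rfl⟩ y hy h f

/-- Every norm exposed face is the face of a geometric tripotent: if `F = F_x`, the component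
`P₂(F)* x` has norm one and exposes the same face. -/
theorem StronglyFaciallySymmetric.exists_tripotent (hSFS : StronglyFaciallySymmetric Z)
    {x : StrongDual ℂ Z} (hne : (normFace x).Nonempty) (hx : ‖x‖ = 1) :
    ∃ u : StrongDual ℂ Z, IsGeometricTripotent u ∧ normFace u = normFace x := by
  have hF : IsSymmetricFace (normFace x) := hSFS.1 _ ⟨hne, x, hx, rfl⟩
  have hxS := hSFS.apply_faceSymm hne hx hx subset_rfl
  let u : StrongDual ℂ Z := x.comp (peirceTwo (normFace x))
  have hu : ∀ f, u f = x (peirceTwo (normFace x) f) := fun _ => rfl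
  have hu1 : ∀ f ∈ normFace x, u f = 1 := fun f hf => by
    rw [hu, hF.peirceTwo_of_mem_closedSpan (subset_closedSpan _ hf), hf.2]
  have hdec : ∀ f, ∃ h ∈ orthSet (normFace x), x f = u f + x h ∧ ‖u f‖ + ‖h‖ ≤ ‖f‖ := by
    intro f
    obtain ⟨h, hh, e⟩ := hF.average_eq f
    refine ⟨h, hh, ?_, ?_⟩
    · rw [hu, ← map_add, ← e, IsSymmetricFace.apply_average _ hxS]
    · have h1 := hF.norm_apply_add_norm_le hu1 (hF.isPeirceTwo_peirceTwo f).1 hh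
      rw [← e, hu, hF.peirceTwo_of_mem_closedSpan (hF.isPeirceTwo_peirceTwo f).1] at h1
      exact h1.trans (IsSymmetricFace.norm_average_le _ f)
  have hle : ∀ f, ‖u f‖ ≤ ‖f‖ := fun f => by
    obtain ⟨h, -, -, h1⟩ := hdec f
    linarith [norm_nonneg h]
  have hun : ‖u‖ = 1 := by
    refine le_antisymm (u.opNorm_le_bound zero_le_one (by simpa using hle)) ?_
    obtain ⟨f, hf⟩ := hne
    have := u.le_opNorm f
    rw [hu1 f hf, norm_eq_one_of_mem_normFace hx.le hf] at this
    simpa using this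
  have hface : normFace u = normFace x := by
    refine Set.Subset.antisymm (fun f hf => ⟨hf.1, ?_⟩) fun f hf => ⟨hf.1, hu1 f hf⟩
    obtain ⟨h, -, h1, h2⟩ := hdec f
    have h3 := hf.1
    rw [hf.2, norm_one] at h2
    have h0 : h = 0 := norm_le_zero_iff.1 (by linarith)
    rw [h1, h0, hf.2, map_zero, add_zero]
  refine ⟨u, ⟨⟨hun, fun f hf => ?_⟩, ?_, fun f => ?_⟩, hface⟩
  · rw [hface] at hf
    rw [hu, hF.peirceTwo_of_mem_orthSet hf, map_zero]
  · rwa [hface]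
  · rw [hface, hu, hF.peirceTwo_faceSymm, ← hu]

/-- A functional `y` of norm one which is `1` on the face of `u` splits as `u + (y - u)`, where all
the combinations `a • u + b • (y - u)` with `|a|, |b| ≤ 1` have norm at most one. -/
theorem IsGeometricTripotent.norm_apply_add_norm_sub_apply_le (hSFS : StronglyFaciallySymmetric Z)
    {u y : StrongDual ℂ Z} (hu : IsGeometricTripotent u) (hy : ‖y‖ = 1)
    (h : normFace u ⊆ normFace y) (f : Z) : ‖u f‖ + ‖y f - u f‖ ≤ ‖f‖ := by
  have hF := hu.symmetric
  have hyS := hSFS.apply_faceSymm hF.1.1 hu.norm_eq hy h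
  rw [← IsSymmetricFace.apply_average _ hyS f, ← IsSymmetricFace.apply_average _ hu.2.2 f]
  refine le_trans ?_ (IsSymmetricFace.norm_average_le (normFace u) f)
  obtain ⟨g, hg, k, hk, e⟩ := hF.exists_add_of_faceSymm_eq (hF.faceSymm_average f)
  rw [e]
  have h1 := hF.norm_apply_add_norm_le (u := u) (fun f hf => hf.2) hg hk
  have h2 := y.le_opNorm k
  have h3 : y g = u g := eqOn_closedSpan (fun f hf => by rw [(h hf).2, hf.2]) g hg
  have h4 : y (g + k) - u (g + k) = y k := by
    rw [map_add, map_add, h3, hu.1.2 k hk]; ring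
  rw [h4, map_add, hu.1.2 k hk, add_zero]
  rw [hy, one_mul] at h2
  linarith

/-- The midpoint of two functionals exposes the intersection of their faces if it is non-empty. -/
theorem normFace_average {x y : StrongDual ℂ Z} (hx : ‖x‖ = 1) (hy : ‖y‖ = 1)
    (hne : (normFace x ∩ normFace y).Nonempty) :
    ‖(2⁻¹ : ℂ) • (x + y)‖ = 1 ∧ normFace ((2⁻¹ : ℂ) • (x + y)) = normFace x ∩ normFace y := by
  have hval : ∀ f, ((2⁻¹ : ℂ) • (x + y)) f = 2⁻¹ * (x f + y f) := fun f => by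
    simp [mul_add]
  have hsub : normFace x ∩ normFace y ⊆ normFace ((2⁻¹ : ℂ) • (x + y)) := by
    rintro f ⟨hfx, hfy⟩
    refine ⟨hfx.1, ?_⟩
    rw [hval, hfx.2, hfy.2]; norm_num
  have hle : ‖(2⁻¹ : ℂ) • (x + y)‖ ≤ 1 := by
    rw [norm_smul]
    have := norm_add_le x y
    norm_num
    linarith
  refine ⟨le_antisymm hle ?_, Set.Subset.antisymm ?_ hsub⟩
  · obtain ⟨f, hf⟩ := hne
    have h1 := ((2⁻¹ : ℂ) • (x + y)).le_opNorm f
    rw [(hsub hf).2, norm_eq_one_of_mem_normFace hx.le hf.1] at h1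
    simpa using h1
  · intro f hf
    have h1 := hf.2
    rw [hval] at h1
    have hbx := (x.le_of_opNorm_le hx.le f).trans (by simpa using hf.1)
    have hby := (y.le_of_opNorm_le hy.le f).trans (by simpa using hf.1)
    obtain ⟨h2, h3⟩ := eq_of_norm_le_of_add_eq hbx hby
      (by push_cast; linear_combination 2 * h1)
    exact ⟨⟨hf.1, by simpa using h2⟩, ⟨hf.1, by simpa using h3⟩⟩

/-! ### Minimal and indecomposable geometric tripotents -/

namespace IsGeometricTripotent

variable {v : StrongDual ℂ Z}

/-- As `U₂ v` is the dual of the closed span of the face of `v`, minimality means that the face is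
a single point. -/
theorem isMinimalTripotent_iff (hv : IsGeometricTripotent v) :
    IsMinimalTripotent v ↔ (normFace v).Subsingleton := by
  have hF := hv.symmetric
  obtain ⟨f, hf⟩ := hF.1.1
  have hvU : v ∈ U₂ v := ⟨v, by ext g; exact hv.apply_peirceTwo g⟩
  have hv0 : v ≠ 0 := fun h => by simpa [h] using hv.norm_eq
  have hne : (⟨v, hvU⟩ : U₂ v) ≠ 0 := fun h => hv0 (congrArg Subtype.val h)
  constructor
  · rintro ⟨-, hfin⟩ g hg k hk
    refine (SeparatingDual.eq_iff_forall_dual_eq (R := ℂ)).2 fun y => ?_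
    have hyU : y.comp (peirceTwo (normFace v)) ∈ U₂ v := ⟨y, rfl⟩
    obtain ⟨c, hc⟩ := (finrank_eq_one_iff_of_nonzero' (K := ℂ) (V := U₂ v) _ hne).1 hfin ⟨_, hyU⟩
    have hc' : ∀ l ∈ normFace v, c = y l := fun l hl => by
      have := congrArg (fun z : U₂ v => (z : StrongDual ℂ Z) l) hc
      simpa [hl.2, hF.peirceTwo_of_mem_closedSpan (subset_closedSpan _ hl)] using this
    rw [← hc' g hg, ← hc' k hk]
  · intro hsub
    refine ⟨hv, (finrank_eq_one_iff_of_nonzero' (K := ℂ) (V := U₂ v) _ hne).2 ?_⟩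
    rintro ⟨_, z, rfl⟩
    refine ⟨z f, Subtype.ext ?_⟩
    ext g
    change z f * v g = z (peirceTwo (normFace v) g)
    have hcl : closedSpan (normFace v) = Submodule.span ℂ {f} := by
      rw [hsub.eq_singleton_of_mem hf, closedSpan_singleton]
    obtain ⟨c, hc⟩ := Submodule.mem_span_singleton.1 (hcl ▸ (hF.isPeirceTwo_peirceTwo g).1)
    rw [← hv.apply_peirceTwo g, ← hc, map_smul, map_smul, hf.2]
    simp [mul_comm]

end IsGeometricTripotent

/-- A non-zero difference of points of the face of `v` is a positive multiple of the difference
of two points of the face at distance two. -/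
theorem HasJordanDecomposition.exists_norm_sub_eq_two {v : StrongDual ℂ Z} (hv : ‖v‖ = 1)
    (hJ : HasJordanDecomposition (normFace v)) {p q : Z} (hp : p ∈ normFace v)
    (hq : q ∈ normFace v) (hpq : p ≠ q) :
    ∃ g ∈ normFace v, ∃ h ∈ normFace v, ∃ s : ℝ, s ≠ 0 ∧ p - q = s • (g - h) ∧ ‖g - h‖ = 2 := by
  obtain ⟨g, hg, h, hh, s, t, hs, ht, e, en⟩ := hJ (p - q)
    (sub_mem (Submodule.subset_span hp) (Submodule.subset_span hq)) (sub_ne_zero.2 hpq)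
  have hst : s = t := by
    have := congrArg v e
    rw [map_sub, map_sub, hp.2, hq.2, ← Complex.coe_smul, ← Complex.coe_smul, map_smul, map_smul,
      hg.2, hh.2] at this
    simp only [sub_self, smul_eq_mul, mul_one] at this
    exact_mod_cast (sub_eq_zero.1 this.symm)
  subst hst
  have e' : p - q = s • (g - h) := by rw [e, smul_sub]
  have hs0 : s ≠ 0 := by
    rintro rfl
    rw [zero_smul] at e'
    exact hpq (sub_eq_zero.1 e')
  refine ⟨g, hg, h, hh, s, hs0, e', ?_⟩
  rw [e', norm_smul, norm_smul, norm_smul, norm_eq_one_of_mem_normFace hv.le hg,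
    norm_eq_one_of_mem_normFace hv.le hh, Real.norm_of_nonneg hs] at en
  have : s * ‖g - h‖ = s * 2 := by linarith
  exact mul_left_cancel₀ hs0 this

/-- Two points of the face of `v` at distance two are separated by a functional, which cuts
out a geometric tripotent `u ≤ v` whose face contains the first but not the second. -/
theorem StronglyFaciallySymmetric.exists_le_tripotent (hSFS : StronglyFaciallySymmetric Z)
    {v : StrongDual ℂ Z} (hv : ‖v‖ = 1) {g h : Z} (hg : g ∈ normFace v) (hh : h ∈ normFace v)
    (hgh : ‖g - h‖ = 2) :
    ∃ u : StrongDual ℂ Z, IsGeometricTripotent u ∧ normFace u ⊆ normFace v ∧ g ∈ normFace u ∧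
      u h = 0 := by
  have hg1 := norm_eq_one_of_mem_normFace hv.le hg
  have hh1 := norm_eq_one_of_mem_normFace hv.le hh
  obtain ⟨y, hy, hyg, hyh⟩ := exists_dual_of_norm_add_eq (a := g) (b := -h) hg1
    (by rw [norm_neg, hg1, hh1, ← sub_eq_add_neg, hgh]; norm_num)
  have hgy : g ∈ normFace v ∩ normFace y := ⟨hg, hg.1, hyg⟩
  obtain ⟨hx, hxF⟩ := normFace_average hv hy ⟨g, hgy⟩
  obtain ⟨u, hu, hux⟩ := hSFS.exists_tripotent (by rw [hxF]; exact ⟨g, hgy⟩) hx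
  rw [hxF] at hux
  refine ⟨u, hu, hux ▸ Set.inter_subset_left, hux ▸ hgy, ?_⟩
  -- `u h` and `v h - u h` add up to `1` without loss of norm, so `0 ≤ u h`; with `y h = -1` in
  -- place of `v h = 1` the opposite inequality follows.
  have h1 := hu.norm_apply_add_norm_sub_apply_le hSFS hv (hux ▸ Set.inter_subset_left) h
  have h2 := hu.norm_apply_add_norm_sub_apply_le hSFS hy (hux ▸ Set.inter_subset_right) h
  have hyh' : y h = -1 := by
    rw [map_neg, norm_neg, hh1] at hyh
    simpa using congrArg Neg.neg hyh
  rw [hh1, hh.2] at h1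
  rw [hh1, hyh'] at h2
  have h3 : u h = ‖u h‖ :=
    (eq_of_norm_le_of_add_eq (z := u h) (w := 1 - u h) le_rfl
      (by linarith : ‖1 - u h‖ ≤ 1 - ‖u h‖) (by push_cast; ring)).1
  have h4 : -u h = ‖u h‖ :=
    (eq_of_norm_le_of_add_eq (z := -u h) (w := 1 + u h) (norm_neg _).le
      (by rw [← norm_neg, show -(1 + u h) = -1 - u h by ring]; linarith :
        ‖1 + u h‖ ≤ 1 - ‖u h‖) (by push_cast; ring)).1
  have h5 : -u h = u h := h4.trans h3.symm
  exact CharZero.neg_eq_self_iff.1 h5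

theorem isIndecomposableTripotent_iff_isMinimalTripotent (hSFS : StronglyFaciallySymmetric Z)
    (hJD : LocallyBaseNormed Z) (v : StrongDual ℂ Z) :
    IsIndecomposableTripotent v ↔ IsMinimalTripotent v := by
  constructor
  · rintro ⟨hv, hind⟩
    refine hv.isMinimalTripotent_iff.2 fun p hp q hq => ?_
    by_contra hpq
    obtain ⟨g, hg, h, hh, -, -, -, hgh⟩ :=
      (hJD.2 _ hv.symmetric).exists_norm_sub_eq_two hv.norm_eq hp hq hpq
    obtain ⟨u, hu, huv, -, huh⟩ := hSFS.exists_le_tripotent hv.norm_eq hg hh hgh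
    rw [hind u hu huv, hh.2] at huh
    exact one_ne_zero huh
  · intro hmin
    have hv := hmin.1
    refine ⟨hv, fun u hu huv => hu.eq_of_normFace_eq hv (Set.Subset.antisymm huv ?_)⟩
    intro f hf
    obtain ⟨g, hg⟩ := hu.symmetric.1.1
    rwa [hv.isMinimalTripotent_iff.1 hmin hf (huv hg)]

/-! ### Splitting a geometric tripotent -/

/-- If `u ≤ w` are geometric tripotents and `u` vanishes at some point `k` of the face of `w`,
then `w - u` is a geometric tripotent, its face contains `k` and is orthogonal to that of `u`. -/
theorem StronglyFaciallySymmetric.exists_add_eq (hSFS : StronglyFaciallySymmetric Z)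
    {u w : StrongDual ℂ Z} (hu : IsGeometricTripotent u) (hw : IsGeometricTripotent w)
    (huw : normFace u ⊆ normFace w) {k : Z} (hk : k ∈ normFace w) (huk : u k = 0) :
    ∃ w' : StrongDual ℂ Z, IsGeometricTripotent w' ∧ k ∈ normFace w' ∧
      normFace w' ⊆ normFace w ∧ normFace u ⊆ orthSet (normFace w') ∧ u + w' = w := by
  have hbd : ∀ f, ‖u f‖ + ‖(w - u) f‖ ≤ ‖f‖ :=
    hu.norm_apply_add_norm_sub_apply_le hSFS hw.norm_eq huw
  have hkx : k ∈ normFace (w - u) := ⟨hk.1, by simp [hk.2, huk]⟩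
  have hxle : ‖w - u‖ ≤ 1 := (w - u).opNorm_le_bound zero_le_one fun f => by
    linarith [hbd f, norm_nonneg (u f)]
  have hx : ‖w - u‖ = 1 := by
    refine le_antisymm hxle ?_
    have h1 := (w - u).le_opNorm k
    rw [hkx.2, norm_eq_one_of_mem_normFace hxle hkx] at h1
    simpa using h1
  obtain ⟨w', hw', hface⟩ := hSFS.exists_tripotent ⟨k, hkx⟩ hx
  have hu0 : ∀ f ∈ normFace w', u f = 0 := fun f hf => by
    rw [hface] at hf
    have h1 := hbd f
    rw [hf.2, norm_one] at h1
    exact norm_le_zero_iff.1 (by linarith [hf.1])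
  have hw'w : normFace w' ⊆ normFace w := fun f hf => by
    have h1 := hu0 f hf
    rw [hface] at hf
    exact ⟨hf.1, by simpa [h1] using hf.2⟩
  have horth : ∀ a ∈ normFace u, ∀ b ∈ normFace w', Orthogonal a b := by
    intro a ha b hb
    have hb0 := hu0 b hb
    rw [hface] at hb
    have ha0 : (w - u) a = 0 := by simp [(huw ha).2, ha.2]
    have ha1 := norm_eq_one_of_mem_normFace hu.norm_eq.le ha
    have hb1 := norm_eq_one_of_mem_normFace hxle hb
    refine ⟨le_antisymm (norm_add_le _ _) ?_, le_antisymm (norm_sub_le _ _) ?_⟩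
    · have h1 := hbd (a + b)
      rw [map_add, map_add, hb0, ha0, ha.2, hb.2] at h1
      rw [ha1, hb1]
      simpa using h1
    · have h1 := hbd (a - b)
      rw [map_sub, map_sub, hb0, ha0, ha.2, hb.2] at h1
      rw [ha1, hb1]
      simpa using h1
  have huw' : normFace u ⊆ orthSet (normFace w') := fun a ha b hb => (horth a ha b hb).symm
  have hw'u : normFace w' ⊆ orthSet (normFace u) := fun b hb a ha => horth a ha b hb
  refine ⟨w', hw', hface ▸ hkx, hw'w, huw', ?_⟩
  have hF := hu.symmetric
  refine hw.symmetric.ext_dual (fun f => ?_) hw.2.2 (fun f hf => ?_) hw.1.2 (fun e he => ?_)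
  · simp [hu.apply_faceSymm_of_subset hw huw, hw'.apply_faceSymm_of_subset hw hw'w]
  · simp [hu.1.2 f (orthSet_anti huw hf), hw'.1.2 f (orthSet_anti hw'w hf)]
  -- on the face of `w`, the `P₀`-component with respect to `u` is a multiple of a point of the face
  -- of `w - u`, where `w'` and `w - u` agree
  · have hwS := hSFS.apply_faceSymm hF.1.1 hu.norm_eq hw.norm_eq huw
    have hw'S := hw'.apply_faceSymm_of_orthogonal hu hw'u
    have hle := (IsSymmetricFace.norm_average_le (normFace u) e).trans he.1
    have ewe := IsSymmetricFace.apply_average _ hwS e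
    have ew'e := IsSymmetricFace.apply_average _ hw'S e
    have eue := IsSymmetricFace.apply_average _ hu.2.2 e
    obtain ⟨g, hg, n, hn, eq⟩ := hF.exists_add_of_faceSymm_eq (hF.faceSymm_average e)
    rw [eq] at hle ewe ew'e eue
    have hwg : w g = u g := eqOn_closedSpan (fun f hf => by rw [(huw hf).2, hf.2]) g hg
    have hun := hu.1.2 n hn
    have hw'g : w' g = 0 := hw'.apply_eq_zero_of_orthogonal hw'u hg
    rw [map_add, hun, add_zero] at eue
    rw [map_add, hw'g, zero_add] at ew'e
    rw [map_add, hwg, he.2] at ewe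
    have h1 := hF.norm_apply_add_norm_le (u := u) (fun f hf => hf.2) hg hn
    have hwn : w n = ‖n‖ := by
      have h2 : ‖u g‖ ≤ 1 - ‖n‖ := by linarith
      have h3 : ‖w n‖ ≤ ‖n‖ := by simpa [hw.norm_eq] using w.le_opNorm n
      exact (eq_of_norm_le_of_add_eq h2 h3 (by rw [ewe]; push_cast; ring)).2
    have hw'n : w' n = w n := by
      by_cases h0 : n = 0
      · simp [h0]
      have hn0 : (‖n‖ : ℂ) ≠ 0 := by simpa using h0
      have hmem : ((‖n‖ : ℂ)⁻¹) • n ∈ normFace w' := by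
        rw [hface]
        refine ⟨by simp [norm_smul, h0], ?_⟩
        rw [map_smul, sub_apply, hun, sub_zero, hwn, smul_eq_mul,
          inv_mul_cancel₀ hn0]
      have := hmem.2
      rw [map_smul, smul_eq_mul, inv_mul_eq_one₀ hn0] at this
      rw [← this, hwn]
    rw [add_apply, ← eue, ← ew'e, hw'n, ewe, he.2]

/-! ### Geometric tripotents colinear with a minimal one -/

/-- If `v` is minimal with face `{f}` and `w` is colinear with `v`, then `-S_v` fixes the face of
`w` pointwise. Otherwise this involution of the face would interchange two points `k₁`, `k₂` of it
at distance two; their half difference is orthogonal to `f`, hence so is `k₁`, and `S_v k₁ = k₁`. -/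
theorem faceSymm_eq_neg_of_colinear (hJD : LocallyBaseNormed Z) {v w : StrongDual ℂ Z}
    (hv : IsMinimalTripotent v) (hw : IsGeometricTripotent w) (hwv : Colinear w v) {k : Z}
    (hk : k ∈ normFace w) : faceSymm (normFace v) k = -k := by
  have hvF := hv.1.symmetric
  obtain ⟨f, hf⟩ := hvF.1.1
  have hvf : normFace v = {f} := (hv.1.isMinimalTripotent_iff.1 hv).eq_singleton_of_mem hf
  have hf1 := norm_eq_one_of_mem_normFace hv.1.norm_eq.le hf
  have hwS := hv.1.apply_faceSymm_of_mem_U₁ hwv.1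
  have hvw : ∀ k ∈ normFace w, v k = 0 := fun k hk => by
    have h1 := hw.apply_faceSymm_of_mem_U₁ hwv.2 k
    rw [hw.symmetric.faceSymm_of_mem_closedSpan (subset_closedSpan _ hk)] at h1
    exact self_eq_neg.1 h1
  have hσ : ∀ k ∈ normFace w, -faceSymm (normFace v) k ∈ normFace w := fun k hk =>
    ⟨by rw [norm_neg, LinearIsometryEquiv.norm_map]; exact hk.1, by
      rw [map_neg, hwS, neg_neg, hk.2]⟩
  by_contra hne
  obtain ⟨g, hg, h, hh, s, hs, e, hgh⟩ := (hJD.2 _ hw.symmetric).exists_norm_sub_eq_two hw.norm_eq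
    hk (hσ k hk) (fun h => hne (by rw [h, neg_neg, ← h]))
  -- symmetrize the decomposition of `k + S_v k` under `-S_v`
  have hSgh : faceSymm (normFace v) (g - h) = g - h := by
    have h1 : faceSymm (normFace v) (k - -faceSymm (normFace v) k) =
        k - -faceSymm (normFace v) k := by
      rw [sub_neg_eq_add, map_add, hvF.faceSymm_faceSymm, add_comm]
    rw [e, ← Complex.coe_smul, map_smul] at h1
    exact smul_right_injective Z (Complex.ofReal_ne_zero.2 hs) h1
  obtain ⟨k₁, hk₁, hk₁def⟩ : ∃ k₁ ∈ normFace w,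
      k₁ = (2⁻¹ : ℂ) • (g + -faceSymm (normFace v) h) :=
    ⟨_, midpoint_mem_normFace hg (hσ h hh), rfl⟩
  have hdiff : k₁ + faceSymm (normFace v) k₁ = g - h := by
    rw [hk₁def, map_smul, map_add, map_neg, hvF.faceSymm_faceSymm, ← smul_add]
    rw [show g + -faceSymm (normFace v) h + (faceSymm (normFace v) g + -h) =
      (g - h) + faceSymm (normFace v) (g - h) by rw [map_sub]; abel, hSgh, ← two_smul ℂ, smul_smul]
    norm_num
  have hghorth : g - h ∈ orthSet (normFace v) := by
    obtain ⟨p, hp, n, hn, e⟩ := hvF.exists_add_of_faceSymm_eq hSgh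
    have hvp : v p = 0 := by
      have := congrArg v e
      rw [map_sub, map_add, hvw g hg, hvw h hh, hv.1.1.2 n hn] at this
      simpa using this.symm
    have hp0 : p = 0 := by
      rw [hvf, closedSpan_singleton] at hp
      obtain ⟨c, rfl⟩ := Submodule.mem_span_singleton.1 hp
      rw [map_smul, hf.2, smul_eq_mul, mul_one] at hvp
      rw [hvp, zero_smul]
    rw [e, hp0, zero_add]
    exact hn
  have hk₁1 := norm_eq_one_of_mem_normFace hw.norm_eq.le hk₁
  -- a functional supporting `±f` and `g - h` supports `k₁`, since `g - h = k₁ + S_v k₁`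
  have hsupp : ∀ a : Z, ‖a‖ = 1 → ‖a + (g - h)‖ = ‖a‖ + ‖g - h‖ → 2 ≤ ‖a + k₁‖ := by
    intro a ha hadd
    obtain ⟨y, hy, hya, hyd⟩ := exists_dual_of_norm_add_eq ha hadd
    rw [hgh, ← hdiff, map_add] at hyd
    obtain ⟨hy1, -⟩ := apply_eq_one_of_apply_add_eq_two hy.le hk₁1.le
      ((LinearIsometryEquiv.norm_map _ _).trans hk₁1).le (by simpa using hyd)
    have := y.le_opNorm (a + k₁)
    rw [map_add, hya, hy1, hy, one_mul] at this
    norm_num at this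
    exact this
  have hk₁orth : k₁ ∈ orthSet (normFace v) := by
    rw [hvf]
    rintro _ rfl
    have h1 := hghorth _ hf
    refine ⟨le_antisymm (norm_add_le _ _) ?_, le_antisymm (norm_sub_le _ _) ?_⟩
    · rw [hf1, hk₁1]
      linarith [hsupp _ hf1 h1.1]
    · rw [hf1, hk₁1, norm_sub_rev, sub_eq_neg_add]
      linarith [hsupp _ ((norm_neg _).trans hf1) h1.neg_left.1]
  have h1 := hwS k₁
  rw [hvF.faceSymm_of_mem_orthSet hk₁orth, hk₁.2] at h1
  norm_num at h1

/-- A vector `x` which is `-1` for `S_w` and `+1` for `S_u`, where `u ≤ w`, is orthogonal to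
the face of `u`. -/
theorem mem_orthSet_of_faceSymm_eq {u w : StrongDual ℂ Z} (hu : IsGeometricTripotent u)
    (hw : IsGeometricTripotent w) (huw : normFace u ⊆ normFace w) {x : Z}
    (hwx : faceSymm (normFace w) x = -x) (hux : faceSymm (normFace u) x = x) :
    x ∈ orthSet (normFace u) := by
  obtain ⟨p, hp, n, hn, rfl⟩ := hu.symmetric.exists_add_of_faceSymm_eq hux
  have hle : closedSpan (normFace u) ≤ closedSpan (normFace w) :=
    Submodule.topologicalClosure_mono (Submodule.span_mono huw)
  have hfix : ∀ f ∈ closedSpan (normFace u), faceSymm (normFace w) f = f := fun f hf =>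
    hw.symmetric.faceSymm_of_mem_closedSpan (hle hf)
  have hSn : faceSymm (normFace w) n ∈ orthSet (normFace u) :=
    IsSymmetricFace.map_mem_orthSet _ (Or.inl fun f hf => hfix f (subset_closedSpan _ hf)) hn
  rw [map_add, hfix p hp] at hwx
  have h2 : (-2 : ℂ) • p = faceSymm (normFace w) n - (-1 : ℂ) • n := by
    rw [neg_smul, two_smul, neg_smul, one_smul, sub_neg_eq_add]
    rw [eq_sub_of_add_eq' hwx]
    abel
  have h3 : (-2 : ℂ) • p ∈ orthSet (normFace u) := by
    rw [h2]
    exact hu.symmetric.sub_mem_orthSet hSn (hu.symmetric.smul_mem_orthSet _ hn)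
  have h4 := hu.symmetric.eq_zero_of_mem_of_mem (Submodule.smul_mem _ _ hp) h3
  have h5 : p = 0 := (smul_eq_zero.1 h4).resolve_left (by norm_num)
  rwa [h5, zero_add]

/-- The point `f` of the face of a minimal geometric tripotent `v` and its image under an involutive
isometry `T` commuting with `S_v` are proportional or orthogonal, because `T f` is the only
point at which `v ∘ T` attains its norm. -/
theorem IsMinimalTripotent.map_eq_or_mem_orthSet {v : StrongDual ℂ Z} (hv : IsMinimalTripotent v)
    {f : Z} (hf : f ∈ normFace v) (T : Z ≃ₗᵢ[ℂ] Z) (hT : ∀ f, T (T f) = f)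
    (hTv : faceSymm (normFace v) (T f) = T f) :
    T f = f ∨ T f = -f ∨ T f ∈ orthSet (normFace v) := by
  have hvs := hv.1.isMinimalTripotent_iff.1 hv
  have hvf : normFace v = {f} := hvs.eq_singleton_of_mem hf
  have hf1 := norm_eq_one_of_mem_normFace hv.1.norm_eq.le hf
  obtain ⟨p, hp, n, hn, e⟩ := hv.1.symmetric.exists_add_of_faceSymm_eq hTv
  have hnorm := hv.1.symmetric.norm_apply_add_norm_le (u := v) (fun f hf => hf.2) hp hn
  rw [hvf, closedSpan_singleton] at hp
  obtain ⟨c, rfl⟩ := Submodule.mem_span_singleton.1 hp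
  rw [← e, T.norm_map, hf1, map_smul, hf.2, smul_eq_mul, mul_one] at hnorm
  have hvTf : v (T f) = c := by
    rw [e, map_add, map_smul, hf.2, hv.1.1.2 n hn]; simp
  by_cases hc : c = 0
  · right; right
    rw [e, hc, zero_smul, zero_add]
    exact hn
  have hval : c * c + v (T n) = 1 := by
    have h1 := congrArg v (congrArg T e)
    rw [hT, hf.2, map_add, map_add, map_smul, map_smul, hvTf, smul_eq_mul] at h1
    exact h1.symm
  have hc1 : ‖c‖ ≤ 1 := by linarith [norm_nonneg n]
  have hvn : ‖v (T n)‖ ≤ ‖n‖ := by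
    have := v.le_opNorm (T n)
    rwa [hv.1.norm_eq, one_mul, T.norm_map] at this
  have hcc : 1 ≤ ‖c‖ * ‖c‖ + ‖n‖ := by
    have := norm_add_le (c * c) (v (T n))
    rw [hval, norm_one, norm_mul] at this
    linarith
  have hcpos := norm_pos_iff.2 hc
  have hc1' : ‖c‖ = 1 := by nlinarith
  have hn0 : n = 0 := norm_le_zero_iff.1 (by linarith)
  rw [hn0, map_zero, map_zero, add_zero] at hval
  rw [hn0, add_zero] at e
  rcases mul_self_eq_one_iff.1 hval with rfl | rfl
  · left; rw [e, one_smul]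
  · right; left; rw [e, neg_smul, one_smul]

/-- Property JP enters through the splitting `w = u + w'` into orthogonal tripotents: on the
`-1` eigenspace of `S_w` it gives `S_{w'} = -S_u`. -/
theorem isMinimalTripotent_of_colinear (hSFS : StronglyFaciallySymmetric Z)
    (hJD : LocallyBaseNormed Z) (hJP : PropertyJP Z) {v w : StrongDual ℂ Z}
    (hv : IsMinimalTripotent v) (hw : IsGeometricTripotent w) (hwv : Colinear w v) :
    IsMinimalTripotent w := by
  refine hw.isMinimalTripotent_iff.2 fun a ha b hb => ?_
  by_contra hab
  obtain ⟨k₁, hk₁w, k₂, hk₂w, -, -, -, hk⟩ :=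
    (hJD.2 _ hw.symmetric).exists_norm_sub_eq_two hw.norm_eq ha hb hab
  obtain ⟨u, hu, huw, -, huk₂⟩ := hSFS.exists_le_tripotent hw.norm_eq hk₁w hk₂w hk
  obtain ⟨w', hw', -, hw'w, horth, hsum⟩ := hSFS.exists_add_eq hu hw huw hk₂w huk₂
  have hSS := hJP u w' hu hw' (hu.mem_U₀_of_orthogonal hw' horth)
  rw [hsum] at hSS
  have hneg := fun k hk => faceSymm_eq_neg_of_colinear hJD hv hw hwv (k := k) hk
  have hvF := hv.1.symmetric
  obtain ⟨f, hf⟩ := hvF.1.1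
  have hvs := hv.1.isMinimalTripotent_iff.1 hv
  have hf1 := norm_eq_one_of_mem_normFace hv.1.norm_eq.le hf
  -- `-S_w f` lies in the face of `v`, which consists of `f` alone
  have hwf : faceSymm (normFace w) f = -f := by
    have hmem : -faceSymm (normFace w) f ∈ normFace v :=
      ⟨by rw [norm_neg, LinearIsometryEquiv.norm_map, hf1],
        by rw [map_neg, hw.apply_faceSymm_of_mem_U₁ hwv.2, neg_neg, hf.2]⟩
    rw [← neg_neg (faceSymm (normFace w) f), hvs hmem hf]
  -- a functional supporting `f` is fixed by `S_v`, so it vanishes on the face of `w`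
  have hcontra : ∀ x, ∀ t : StrongDual ℂ Z, IsGeometricTripotent t → normFace t ⊆ normFace w →
      (∀ y : StrongDual ℂ Z, ‖y‖ = 1 → y x = 1 → y f = 1) → ‖x‖ = 1 →
      faceSymm (normFace w) x = -x → faceSymm (normFace t) x = x → False := by
    intro x t ht htw hxf hx hwx htx
    obtain ⟨k, hkt⟩ := ht.symmetric.1.1
    obtain ⟨y, hy, hyx, hyk⟩ := exists_dual_of_norm_add_eq hx
      (mem_orthSet_of_faceSymm_eq ht hw htw hwx htx k hkt).symm.1
    have hyf := hxf y hy hyx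
    have hyS := hSFS.apply_faceSymm hvF.1.1 hv.1.norm_eq hy
      (fun g hg => ⟨hg.1, by rw [hvs hg hf, hyf]⟩) k
    rw [hneg k (htw hkt), map_neg, neg_eq_self, hyk,
      norm_eq_one_of_mem_normFace ht.norm_eq.le hkt] at hyS
    norm_num at hyS
  have hSu := hu.symmetric.faceSymm_faceSymm
  have hTv : faceSymm (normFace v) (faceSymm (normFace u) f) = faceSymm (normFace u) f := by
    rw [← hu.symmetric.commute_faceSymm_of_eq (faceSymm (normFace v)) hvF.faceSymm_faceSymm
      (Or.inr fun k hk => hneg k (huw hk)), hvF.faceSymm_of_mem_closedSpan (subset_closedSpan _ hf)]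
  have hwu : faceSymm (normFace w) (faceSymm (normFace u) f) = -faceSymm (normFace u) f := by
    rw [← hu.symmetric.commute_faceSymm_of_eq (faceSymm (normFace w))
      hw.symmetric.faceSymm_faceSymm (Or.inl fun k hk =>
        hw.symmetric.faceSymm_of_mem_closedSpan (subset_closedSpan _ (huw hk))), hwf, map_neg]
  rcases hv.map_eq_or_mem_orthSet hf (faceSymm (normFace u)) hSu hTv with h | h | h
  · exact hcontra f u hu huw (fun _ _ h => h) hf1 hwf h
  · refine hcontra f w' hw' hw'w (fun _ _ h => h) hf1 hwf ?_
    have h1 := hSS f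
    rw [hwf, ← h] at h1
    exact (faceSymm (normFace u)).injective h1
  -- here `f` and `S_u f` are orthogonal, and their midpoint plays the role of `f`
  · have hadd := (h f hf).1
    rw [LinearIsometryEquiv.norm_map, hf1] at hadd
    refine hcontra ((2⁻¹ : ℂ) • (f + faceSymm (normFace u) f)) u hu huw ?_ ?_ ?_
      (hu.symmetric.faceSymm_average f)
    · intro y hy hyx
      rw [map_smul, map_add, smul_eq_mul] at hyx
      exact (apply_eq_one_of_apply_add_eq_two hy.le hf1.le
        ((LinearIsometryEquiv.norm_map _ _).trans hf1).le (by linear_combination 2 * hyx)).1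
    · rw [norm_smul, hadd]; norm_num
    · rw [map_smul, map_add, hwf, hwu, ← neg_add, smul_neg]

end FacialSymmetry

theorem mainTheorem7 (Z : Type*) [NormedAddCommGroup Z] [NormedSpace ℂ Z]
    (hSFS : FacialSymmetry.StronglyFaciallySymmetric Z)
    (hJD : FacialSymmetry.LocallyBaseNormed Z) :
    {v : StrongDual ℂ Z | FacialSymmetry.IsIndecomposableTripotent v} =
        {v : StrongDual ℂ Z | FacialSymmetry.IsMinimalTripotent v} ∧
      (FacialSymmetry.Neutral Z → FacialSymmetry.PropertyJP Z →
        ∀ v w : StrongDual ℂ Z, FacialSymmetry.IsMinimalTripotent v →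
          FacialSymmetry.IsGeometricTripotent w → FacialSymmetry.Colinear w v →
            FacialSymmetry.IsMinimalTripotent w) := by
  refine ⟨Set.ext fun v =>
    FacialSymmetry.isIndecomposableTripotent_iff_isMinimalTripotent hSFS hJD v, ?_⟩
  intro _ hJP v w hv hw hwv
  exact FacialSymmetry.isMinimalTripotent_of_colinear hSFS hJD hJP hv hw hwv
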